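/- **Setting.** Let $G=\prod_{k\in\mathbb N}\mathbb Z_2$ be the dyadic group with normalized Haar measure $\mu$ (where $\mathbb N=\{0,1,2,\dots\}$), with dyadic intervals $I_n(x)=\{y\in G: y_0=x_0,\dots,y_{n-1}=x_{n-1}\}$ and the filtration $(\zeta_n)$, $\zeta_n$ being the $\sigma$-algebra generated by the sets $I_n(x)$. For $n=\sum_k n_k2^k$, $n_k\in\{0,1\}$, let $w_n(x)=\prod_k(-1)^{n_kx_k}$ be the Walsh functions. For an integrable $f$ put $\widehat f(k)=\int_G f w_k\,d\mu$, for a (real) martingale $F=(F_n)$ with respect to $(\zeta_n)$ put $\widehat F(k)=\lim_{n\to\infty}\int_G F_nw_k\,d\mu$, and let $S_Nf=\sum_{k<N}\widehat f(k)w_k$, $S_NF=\sum_{k<N}\widehat F(k)w_k$. For $0<p<\infty$ let $\|g\|_{\text{weak-}L_p}^p=\sup_{t>0}t^p\mu(|g|>t)$. Let $\|F\|_{H_p}=\|\sup_n|F_n|\|_{p}$, and let $H_p(G)$ be the set of martingales for which it is finite; for integrable $f$, $\|f\|_{H_p}=\|f^*\|_p$ with $f^*(x)=\sup_n\mu(I_n(x))^{-1}\left|\int_{I_n(x)}f\,d\mu\right|$.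 A $p$-atom is a bounded measurable function $a$ for which there is a dyadic interval $I$ with $\int_G a\,d\mu=0$, $\|a\|_\infty\le\mu(I)^{-1/p}$ and $\operatorname{supp}a\subset I$. Finally let $N_n=2^n+2^{\lfloor n/2\rfloor}$ for $n\in\mathbb N$ (so $N_n=2^n+2^{n/2}$ for even $n$). **Corollary 3.** Let $0<p<1$. a) There is a constant $C_p$, depending only on $p$, such that for every $F\in H_p(G)$ $$\left\|\sup_{n\in\mathbb N}\frac{|S_{N_n}F|}{2^{\frac n2(1/p-1)}}\right\|_{\text{weak-}L_p}\le C_p\|F\|_{H_p}.$$ b) (Sharpness) Let $\varphi:\mathbb N\to[1,\infty)$ be nondecreasing. (i) If $\limsup_{n\to\infty}2^{\frac n2(1/p-1)}/\varphi(n)=\infty$, then there is a sequence $(f_n)_{n\in\mathbb N}$ of $p$-atoms such that $$\sup_{n\text{ even}}\frac{\left\|S_{N_n}f_n/\varphi(n)\right\|_{\text{weak-}L_p}}{\|f_n\|_{H_p}}=\infty .$$ (ii) If $\limsup_{n\to\infty}2^{\frac n2(1/p-1)}/\varphi(N_n)=\infty$, then there is a sequence $(f_n)_{n\in\mathbb N}$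 of $p$-atoms such that $$\sup_{n\text{ even}}\frac{\left\|S_{N_n}f_n/\varphi(N_n)\right\|_{\text{weak-}L_p}}{\|f_n\|_{H_p}}=\infty .$$ In particular the suprema over all $n\in\mathbb N$ are infinite as well. -/

import Mathlib

open MeasureTheory Filter
open scoped ENNReal NNReal

noncomputable section

namespace WalshHardy

/-- The dyadic (Walsh) group: the complete direct product of countably many copies of the cyclic
group of order two. -/
abbrev G : Type := ℕ → Fin 2

/-- The measure on the two-point group that gives mass `1/2` to each singleton. -/
def coin : Measure (Fin 2) := (2 : ℝ≥0∞)⁻¹ • Measure.count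

instance : IsProbabilityMeasure coin where
  measure_univ := by
    simp only [coin, Measure.smul_apply, smul_eq_mul, Measure.count_univ]
    simp [ENNReal.inv_mul_cancel]

/-- The normalized Haar measure of the dyadic group, i.e. the product of the measures `coin`. -/
def haarG : Measure G := Measure.infinitePi (fun _ : ℕ => coin)

instance : IsProbabilityMeasure haarG := by
  unfold haarG; infer_instance

/-- The dyadic interval `I_n(x)`: all `y` with `y_0 = x_0, …, y_{n-1} = x_{n-1}`. -/
def I (n : ℕ) (x : G) : Set G := {y | ∀ i < n, y i = x i}

lemma measurableSet_I (n : ℕ) (x : G) : MeasurableSet (I n x) := by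
  have h : I n x = ⋂ i ∈ Finset.range n, (fun y : G => y i) ⁻¹' {x i} := by
    ext y; simp [I]
  rw [h]
  exact Finset.measurableSet_biInter _ fun i _ =>
    (measurable_pi_apply i) (MeasurableSet.singleton _)

lemma I_eq_iUnion (n : ℕ) (x : G) :
    I n x = ⋃ b : Fin 2, I (n + 1) (Function.update x n b) := by
  ext y
  simp only [I, Set.mem_ofPred_eq, Set.mem_iUnion]
  constructor
  · intro h
    refine ⟨y n, fun i hi => ?_⟩
    rcases Nat.lt_succ_iff_lt_or_eq.mp hi with h1 | h1
    · rw [Function.update_of_ne h1.ne, h i h1]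
    · subst h1; simp
  · rintro ⟨b, h⟩ i hi
    rw [h i (by omega), Function.update_of_ne hi.ne]

/-- The dyadic filtration: `dyadic n` is the σ-algebra generated by the intervals `I_n(x)`. -/
def dyadic : Filtration ℕ (inferInstance : MeasurableSpace G) where
  seq n := MeasurableSpace.generateFrom (Set.range (I n))
  mono' := by
    refine monotone_nat_of_le_succ fun n => MeasurableSpace.generateFrom_le ?_
    rintro _ ⟨x, rfl⟩
    rw [I_eq_iUnion]
    exact @MeasurableSet.iUnion _ _ (MeasurableSpace.generateFrom (Set.range (I (n + 1)))) _ _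
      fun b => MeasurableSpace.measurableSet_generateFrom ⟨_, rfl⟩
  le' n := by
    refine MeasurableSpace.generateFrom_le ?_
    rintro _ ⟨x, rfl⟩
    exact measurableSet_I n x

/-- The Rademacher function `r_k(x) = (-1)^{x_k}`. -/
def rademacher (k : ℕ) (x : G) : ℝ := (-1) ^ (x k : ℕ)

/-- The Walsh function `w_n = ∏_k r_k^{n_k}`, with `n_k` the `k`-th binary digit of `n`
(these digits vanish for `k ≥ n`, as `n < 2^n`). -/
def walsh (n : ℕ) (x : G) : ℝ := ∏ k ∈ Finset.range n, rademacher k x ^ (n / 2 ^ k % 2)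

/-- The `k`-th Walsh-Fourier coefficient of an integrable function. -/
def coeff (f : G → ℝ) (k : ℕ) : ℝ := ∫ x, f x * walsh k x ∂haarG

/-- The partial sum `S_N f = ∑_{k < N} f̂(k) w_k` of the Walsh-Fourier series of a function. -/
def S (N : ℕ) (f : G → ℝ) (x : G) : ℝ := ∑ k ∈ Finset.range N, coeff f k * walsh k x

/-- The `k`-th Walsh-Fourier coefficient of a martingale, `lim_n ∫ F_n w_k`. For a martingale with
respect to `dyadic` the sequence is constant for `2 ^ n > k`, so the limit exists. -/
def martCoeff (F : ℕ → G → ℝ) (k : ℕ) : ℝ :=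
  limUnder atTop fun n : ℕ => ∫ x, F n x * walsh k x ∂haarG

/-- The partial sum `S_N F = ∑_{k < N} F̂(k) w_k` of the Walsh-Fourier series of a martingale. -/
def martS (N : ℕ) (F : ℕ → G → ℝ) (x : G) : ℝ :=
  ∑ k ∈ Finset.range N, martCoeff F k * walsh k x

/-- The quasi-norm of `L_p(G)`, for nonnegative functions with values in `[0, ∞]`. -/
def lpNorm (p : ℝ) (g : G → ℝ≥0∞) : ℝ≥0∞ := (∫⁻ x, g x ^ p ∂haarG) ^ (1 / p)

/-- The quasi-norm of weak-`L_p(G)`, for nonnegative functions with values in `[0, ∞]`: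
its `p`-th power is the supremum of `t ^ p * μ(g > t)` over real `t > 0`. -/
def weakLpNorm (p : ℝ) (g : G → ℝ≥0∞) : ℝ≥0∞ :=
  (⨆ (t : ℝ≥0) (_ : 0 < t), (t : ℝ≥0∞) ^ p * haarG {x | (t : ℝ≥0∞) < g x}) ^ (1 / p)

/-- The maximal function `F^* = sup_n |F_n|` of a martingale. -/
def martMaximal (F : ℕ → G → ℝ) (x : G) : ℝ≥0∞ := ⨆ n : ℕ, ENNReal.ofReal |F n x|

/-- The `H_p` quasi-norm of a martingale. -/
def martHpNorm (p : ℝ) (F : ℕ → G → ℝ) : ℝ≥0∞ := lpNorm p (martMaximal F)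

/-- Membership in the martingale Hardy space `H_p(G)`. -/
def MemHp (p : ℝ) (F : ℕ → G → ℝ) : Prop :=
  Martingale F dyadic haarG ∧ martHpNorm p F < ∞

/-- The maximal function of an integrable function: the supremum over `n` of the absolute values
of its averages over `I_n(x)`. -/
def maximal (f : G → ℝ) (x : G) : ℝ≥0∞ :=
  ⨆ n : ℕ, ENNReal.ofReal |⨍ u in I n x, f u ∂haarG|

/-- The `H_p` quasi-norm of an integrable function. -/
def hpNorm (p : ℝ) (f : G → ℝ) : ℝ≥0∞ := lpNorm p (maximal f)

/-- `p`-atoms: bounded measurable functions `a` such that, for some dyadic interval `I`,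
`∫ a = 0`, `‖a‖_∞ ≤ μ(I)^{-1/p}` and `supp a ⊆ I`. -/
def IsAtom (p : ℝ) (a : G → ℝ) : Prop :=
  Measurable a ∧ (∃ C : ℝ, ∀ x, |a x| ≤ C) ∧
    ∃ (n : ℕ) (z : G), ∫ x, a x ∂haarG = 0 ∧
      eLpNorm a ∞ haarG ≤ haarG (I n z) ^ (-(1 / p)) ∧
      Function.support a ⊆ I n z

/-- The index `2^n + 2^{⌊n/2⌋}` (natural-number division). -/
def idx (n : ℕ) : ℕ := 2 ^ n + 2 ^ (n / 2)

/-- The weight `2^{(n/2)(1/p-1)}` (real division). -/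
def weight (p : ℝ) (n : ℕ) : ℝ := (2 : ℝ) ^ ((n : ℝ) / 2 * (1 / p - 1))

/-- The weighted maximal operator `sup_n |S_{2^n+2^{⌊n/2⌋}} F| / 2^{(n/2)(1/p-1)}`. -/
def maxOp (p : ℝ) (F : ℕ → G → ℝ) (x : G) : ℝ≥0∞ :=
  ⨆ n : ℕ, ENNReal.ofReal (|martS (idx n) F x| / weight p n)

end WalshHardy

end

/-!
Both halves rest on the formula for the Walsh–Dirichlet kernel of order `2 ^ n + 2 ^ m` with
`m = ⌊n / 2⌋`, see `sum_walsh_idx`: it is `2 ^ n 1_{I_n(x)}(y) + r_n(x) r_n(y) 2 ^ m 1_{I_m(x)}(y)`.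

*Boundedness.* The partial sum of `F` of this order is the partial sum of the function `F_{n+1}`, so
its modulus is at most the sum of the averages of `|F_{n+1}|` over `I_n(x)` and `I_m(x)`. Since
`F_{n+1}` is constant on the intervals of generation `n + 1`, the inequality between the `ℓ_1` and
`ℓ_p` norms bounds the `p`-th power of such an average over `I_j(x)` by `2 ^ ((1 - p) (n + 1 - j))`
times the average of `|F_{n+1}| ^ p ≤ (F^*) ^ p` (`avg_rpow_le`). For `j = m` and `j = n` the factor
is at most a constant times the `p`-th power of the weight. Hence the `p`-th power of the weighted
maximal operator is pointwise dominated by the dyadic maximal function of the integrable function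
`(F^*) ^ p` (`maxOp_rpow_le`), and the weak type `(1, 1)` inequality for the latter
(`mul_haarG_dyadicMax_le`) gives the claim without an atomic decomposition.

*Sharpness.* The atom `blockAtom p n = 2 ^ (n / p) r_n 1_{I_n(0)}` has `H_p` quasi-norm at most `1`.
The first part of the kernel annihilates it and the second part spreads it over `I_m(0)`, where the
partial sum has modulus `2 ^ (m + n / p - n)`. For even `n` its weak-`L_p` quasi-norm is therefore
comparable to the weight; odd `n` are reduced to even ones by the monotonicity of the normalizing
function (`iSup_weakLpNorm_blockAtom`).
-/

namespace WalshHardy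

/-! ### Dyadic intervals and the dyadic filtration -/

lemma I_antitone {m n : ℕ} (h : m ≤ n) (x : G) : I n x ⊆ I m x :=
  fun _ hy i hi => hy i (hi.trans_le h)

lemma mem_I_comm {n : ℕ} {x y : G} : y ∈ I n x ↔ x ∈ I n y :=
  ⟨fun h i hi => (h i hi).symm, fun h i hi => (h i hi).symm⟩

lemma I_eq_of_mem {n : ℕ} {x y : G} (h : y ∈ I n x) : I n y = I n x := by
  ext z
  exact ⟨fun hz i hi => (hz i hi).trans (h i hi), fun hz i hi => (hz i hi).trans (h i hi).symm⟩

lemma mem_I_succ_iff {n : ℕ} {x y : G} (hy : y ∈ I n x) : y ∈ I (n + 1) x ↔ y n = x n :=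
  ⟨fun h => h n n.lt_succ_self, fun h i hi =>
    (Nat.lt_succ_iff_lt_or_eq.1 hi).elim (hy i) fun e => e ▸ h⟩

lemma haarG_I (n : ℕ) (x : G) : haarG (I n x) = ((2 : ℝ≥0∞) ^ n)⁻¹ := by
  have h : I n x = Set.pi (Finset.range n : Set ℕ) fun i => {x i} := by
    ext y; simp [I, Set.mem_pi]
  have hc : ∀ b : Fin 2, coin {b} = (2 : ℝ≥0∞)⁻¹ := fun b => by simp [coin]
  rw [h, haarG, Measure.infinitePi_pi _ fun i _ => MeasurableSet.singleton _]
  simp [hc, ENNReal.inv_pow]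

lemma haarG_real_I (n : ℕ) (x : G) : haarG.real (I n x) = ((2 : ℝ) ^ n)⁻¹ := by
  simp [Measure.real, haarG_I]

lemma two_pow_mul_haarG_I (n : ℕ) (x : G) : (2 : ℝ≥0∞) ^ n * haarG (I n x) = 1 := by
  rw [haarG_I, ENNReal.mul_inv_cancel (by positivity) (by finiteness)]

/-- The point of `G` whose first `n` coordinates are given and whose other coordinates vanish;
these points represent the `2 ^ n` dyadic intervals of generation `n`. -/
def extendZero {n : ℕ} (s : Fin n → Fin 2) : G := fun i => if h : i < n then s ⟨i, h⟩ else 0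

lemma mem_I_extendZero {n : ℕ} (s : Fin n → Fin 2) (y : G) :
    y ∈ I n (extendZero s) ↔ s = fun i : Fin n => y i := by
  constructor
  · intro h
    ext i
    have := h i i.2
    simp only [extendZero, i.2, dif_pos] at this
    simp [this]
  · rintro rfl i hi
    simp [extendZero, hi]

lemma pairwiseDisjoint_I_extendZero (n : ℕ) (T : Set (Fin n → Fin 2)) :
    T.PairwiseDisjoint fun s => I n (extendZero s) := by
  intro s _ t _ hst
  refine Set.disjoint_left.2 fun y hs ht => hst ?_
  rw [(mem_I_extendZero s y).1 hs, (mem_I_extendZero t y).1 ht]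

open Classical in
/-- A set that is a union of dyadic intervals of generation `n` is a finite disjoint union of
such intervals. -/
lemma eq_biUnion_I {n : ℕ} {A : Set G} (hA : ∀ x ∈ A, I n x ⊆ A) :
    A = ⋃ s ∈ Finset.univ.filter fun s : Fin n → Fin 2 => extendZero s ∈ A,
      I n (extendZero s) := by
  ext y
  simp only [Finset.mem_filter, Finset.mem_univ, true_and, Set.mem_iUnion, exists_prop]
  constructor
  · intro hy
    have hm : y ∈ I n (extendZero fun i : Fin n => y i) := (mem_I_extendZero _ _).2 rfl
    exact ⟨_, hA y hy (mem_I_comm.1 hm), hm⟩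
  · rintro ⟨s, hs, hy⟩
    exact hA _ hs hy

lemma measurableSet_dyadic_iff {n : ℕ} {A : Set G} :
    MeasurableSet[dyadic n] A ↔ ∀ x ∈ A, I n x ⊆ A := by
  constructor
  · intro h
    have : ∀ x y, y ∈ I n x → (x ∈ A ↔ y ∈ A) := by
      refine MeasurableSpace.generateFrom_induction (Set.range (I n))
        (fun A _ => ∀ x y, y ∈ I n x → (x ∈ A ↔ y ∈ A)) ?_ ?_ ?_ ?_ A h
      · rintro _ ⟨z, rfl⟩ _ x y hxy
        rw [mem_I_comm (x := z), mem_I_comm (x := z), I_eq_of_mem hxy]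
      · simp
      · intro t _ ht x y hxy
        simp [ht x y hxy]
      · intro s _ hs x y hxy
        simp [fun i => hs i x y hxy]
    exact fun x hx y hy => (this x y hy).1 hx
  · intro h
    classical
    rw [eq_biUnion_I h]
    exact @Finset.measurableSet_biUnion _ _ (dyadic n) _ _ fun s _ =>
      MeasurableSpace.measurableSet_generateFrom ⟨_, rfl⟩

lemma eq_of_stronglyMeasurable_dyadic {n : ℕ} {f : G → ℝ} (hf : StronglyMeasurable[dyadic n] f)
    {x y : G} (h : y ∈ I n x) : f y = f x :=
  measurableSet_dyadic_iff.1 (hf.measurable (measurableSet_singleton (f x))) x rfl h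

lemma stronglyMeasurable_dyadic_of_eq {n : ℕ} {f : G → ℝ} (hf : ∀ x, ∀ y ∈ I n x, f y = f x) :
    StronglyMeasurable[dyadic n] f := by
  have h : Measurable[dyadic n] f := fun s _ => by
    refine measurableSet_dyadic_iff.2 fun x hx y hy => ?_
    rw [Set.mem_preimage, hf x y hy]
    exact hx
  exact h.stronglyMeasurable

/-! ### Walsh functions and the Walsh–Dirichlet kernels -/

lemma rademacher_eq_one_or (k : ℕ) (x : G) : rademacher k x = 1 ∨ rademacher k x = -1 :=
  neg_one_pow_eq_or ℝ _

lemma abs_rademacher (k : ℕ) (x : G) : |rademacher k x| = 1 := by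
  rcases rademacher_eq_one_or k x with h | h <;> simp [h]

lemma abs_walsh (n : ℕ) (x : G) : |walsh n x| = 1 := by
  simp [walsh, Finset.abs_prod, abs_pow, abs_rademacher]

/-- In the product defining `walsh k`, the range of the index may be cut off at any `n` with
`k < 2 ^ n`. -/
lemma walsh_eq_prod {k n : ℕ} (h : k < 2 ^ n) (x : G) :
    walsh k x = ∏ j ∈ Finset.range n, rademacher j x ^ (k / 2 ^ j % 2) := by
  have key : ∀ a b : ℕ, k < 2 ^ a → a ≤ b →
      ∏ j ∈ Finset.range a, rademacher j x ^ (k / 2 ^ j % 2) =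
        ∏ j ∈ Finset.range b, rademacher j x ^ (k / 2 ^ j % 2) := by
    intro a b ha hab
    refine Finset.prod_subset (Finset.range_mono hab) fun j _ hj => ?_
    have : k < 2 ^ j := ha.trans_le (Nat.pow_le_pow_right two_pos (by simpa using hj))
    simp [Nat.div_eq_of_lt this]
  rw [walsh, key k (max k n) Nat.lt_two_pow_self (le_max_left _ _),
    key n (max k n) h (le_max_right _ _)]

lemma walsh_eq_of_mem_I {k n : ℕ} (h : k < 2 ^ n) {x y : G} (hy : y ∈ I n x) :
    walsh k y = walsh k x := by
  rw [walsh_eq_prod h, walsh_eq_prod h]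
  refine Finset.prod_congr rfl fun j hj => ?_
  simp [rademacher, hy j (Finset.mem_range.1 hj)]

lemma walsh_two_pow_add {k n : ℕ} (h : k < 2 ^ n) (x : G) :
    walsh (2 ^ n + k) x = rademacher n x * walsh k x := by
  rw [walsh_eq_prod (n := n + 1) (by rw [pow_succ]; omega), walsh_eq_prod h,
    Finset.prod_range_succ, mul_comm]
  congr 1
  · rw [Nat.add_div_left _ (by positivity), Nat.div_eq_of_lt h]
    simp
  · refine Finset.prod_congr rfl fun j hj => ?_
    have hj : j < n := Finset.mem_range.1 hj
    obtain ⟨d, rfl⟩ := Nat.exists_eq_add_of_lt hj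
    rw [show 2 ^ (j + d + 1) + k = k + 2 ^ j * (2 * 2 ^ d) by ring,
      Nat.add_mul_div_left _ _ (by positivity), Nat.add_mul_mod_self_left]

lemma measurable_rademacher (k : ℕ) : Measurable (rademacher k) :=
  (measurable_of_countable fun b : Fin 2 => (-1 : ℝ) ^ (b : ℕ)).comp (measurable_pi_apply k)

lemma measurable_walsh (n : ℕ) : Measurable (walsh n) :=
  Finset.measurable_fun_prod _ fun k _ => (measurable_rademacher k).pow_const _

/-- The Walsh–Dirichlet kernel of order `2 ^ n` is `2 ^ n` times the indicator of the dyadic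
intervals of generation `n`. -/
lemma sum_walsh_two_pow (n : ℕ) (x y : G) :
    ∑ k ∈ Finset.range (2 ^ n), walsh k x * walsh k y = (I n x).indicator (fun _ => 2 ^ n) y := by
  induction n with
  | zero => simp [walsh, I]
  | succ n ih =>
    have h1 : ∑ k ∈ Finset.range (2 ^ n), walsh (2 ^ n + k) x * walsh (2 ^ n + k) y =
        rademacher n x * rademacher n y *
          ∑ k ∈ Finset.range (2 ^ n), walsh k x * walsh k y := by
      rw [Finset.mul_sum]
      refine Finset.sum_congr rfl fun k hk => ?_
      rw [walsh_two_pow_add (Finset.mem_range.1 hk), walsh_two_pow_add (Finset.mem_range.1 hk)]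
      ring
    rw [pow_succ, mul_two, Finset.sum_range_add, h1, ih]
    by_cases hy : y ∈ I n x
    · have hiff := mem_I_succ_iff hy
      have hr : rademacher n x * rademacher n y = if y n = x n then 1 else -1 := by
        unfold rademacher
        generalize x n = a
        generalize y n = b
        fin_cases a <;> fin_cases b <;> simp
      rw [hr]
      by_cases h : y n = x n
      · simp [Set.indicator_of_mem, hy, hiff.2 h, h]; ring
      · simp [Set.indicator_of_mem, hy, mt hiff.1 h, h]
    · have : y ∉ I (n + 1) x := fun h => hy (I_antitone n.le_succ x h)
      simp [hy, this]

/-- The Walsh–Dirichlet kernel of order `2 ^ n + 2 ^ ⌊n / 2⌋`. -/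
lemma sum_walsh_idx (n : ℕ) (x y : G) :
    ∑ k ∈ Finset.range (idx n), walsh k x * walsh k y =
      (I n x).indicator (fun _ => 2 ^ n) y +
        rademacher n x * rademacher n y * (I (n / 2) x).indicator (fun _ => 2 ^ (n / 2)) y := by
  rw [idx, Finset.sum_range_add, sum_walsh_two_pow, ← sum_walsh_two_pow (n / 2), Finset.mul_sum]
  congr 1
  refine Finset.sum_congr rfl fun k hk => ?_
  have hk : k < 2 ^ n :=
    (Finset.mem_range.1 hk).trans_le (Nat.pow_le_pow_right two_pos (Nat.div_le_self n 2))
  rw [walsh_two_pow_add hk, walsh_two_pow_add hk]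
  ring

lemma integrable_mul_walsh {f : G → ℝ} (hf : Integrable f haarG) (k : ℕ) :
    Integrable (fun x => f x * walsh k x) haarG :=
  hf.mul_bdd (c := 1) (measurable_walsh k).aestronglyMeasurable
    (ae_of_all _ fun x => by rw [Real.norm_eq_abs, abs_walsh])

lemma S_eq_integral {f : G → ℝ} (hf : Integrable f haarG) (N : ℕ) (x : G) :
    S N f x = ∫ y, f y * ∑ k ∈ Finset.range N, walsh k x * walsh k y ∂haarG := by
  simp_rw [Finset.mul_sum]
  rw [integral_finsetSum]
  · refine Finset.sum_congr rfl fun k _ => ?_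
    rw [coeff, ← integral_mul_const]
    congr 1 with y
    ring
  · intro k _
    exact ((integrable_mul_walsh hf k).const_mul (walsh k x)).congr
      (ae_of_all _ fun y => by ring)

/-! ### The dyadic maximal function -/

/-- The average of `g` over the dyadic interval `I_m(x)`, which has measure `2 ^ (-m)`. -/
noncomputable def avg (g : G → ℝ≥0∞) (m : ℕ) (x : G) : ℝ≥0∞ := 2 ^ m * ∫⁻ y in I m x, g y ∂haarG

/-- The dyadic maximal function of a `[0, ∞]`-valued function. -/
noncomputable def dyadicMax (g : G → ℝ≥0∞) (x : G) : ℝ≥0∞ := ⨆ m, avg g m x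

lemma avg_mono {g h : G → ℝ≥0∞} (hgh : ∀ x, g x ≤ h x) (m : ℕ) (x : G) :
    avg g m x ≤ avg h m x :=
  mul_le_mul_right (lintegral_mono hgh) _

lemma avg_le_dyadicMax (g : G → ℝ≥0∞) (m : ℕ) (x : G) : avg g m x ≤ dyadicMax g x :=
  le_iSup (fun m => avg g m x) m

/-- If `B` is a union of dyadic intervals of generation `m` over each of which the average of `g`
is at least `s`, then so is the average of `g` over `B`. -/
lemma mul_haarG_le_setLIntegral {g : G → ℝ≥0∞} {s : ℝ≥0∞} {m : ℕ} {B : Set G}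
    (hB : ∀ x ∈ B, I m x ⊆ B) (hs : ∀ x ∈ B, s ≤ avg g m x) :
    s * haarG B ≤ ∫⁻ y in B, g y ∂haarG := by
  classical
  rw [eq_biUnion_I hB, lintegral_biUnion_finset (pairwiseDisjoint_I_extendZero m _)
    fun _ _ => measurableSet_I _ _]
  refine (mul_le_mul_right (measure_biUnion_finset_le _ _) _).trans ?_
  rw [Finset.mul_sum]
  refine Finset.sum_le_sum fun t ht => ?_
  refine (mul_le_mul_left (hs _ (Finset.mem_filter.1 ht).2) _).trans_eq ?_
  rw [avg, mul_right_comm, two_pow_mul_haarG_I, one_mul]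

/-- The weak type `(1, 1)` inequality for the dyadic maximal function, with constant `1`. -/
lemma mul_haarG_dyadicMax_le (g : G → ℝ≥0∞) (s : ℝ≥0∞) :
    s * haarG {x | s < dyadicMax g x} ≤ ∫⁻ y, g y ∂haarG := by
  -- `disjointed A m` consists of the points whose first average exceeding `s` is the `m`-th one.
  set A : ℕ → Set G := fun m => {x | s < avg g m x} with hA
  have hsat : ∀ m, ∀ x ∈ disjointed A m, I m x ⊆ disjointed A m := by
    intro m x hx y hy
    have hiff : ∀ j ≤ m, (y ∈ A j ↔ x ∈ A j) := fun j hj => by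
      simp only [hA, Set.mem_ofPred_eq, avg, I_eq_of_mem (I_antitone hj x hy)]
    rw [disjointed_eq_inter_compl] at hx ⊢
    simp only [Set.mem_inter_iff, Set.mem_iInter, Set.mem_compl_iff] at hx ⊢
    exact ⟨(hiff m le_rfl).2 hx.1, fun j hj h => hx.2 j hj ((hiff j hj.le).1 h)⟩
  have hmeas : ∀ m, MeasurableSet (disjointed A m) := fun m =>
    dyadic.le m _ (measurableSet_dyadic_iff.2 (hsat m))
  have hU : {x | s < dyadicMax g x} = ⋃ m, disjointed A m := by
    rw [iUnion_disjointed]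
    ext x
    simp [hA, dyadicMax, lt_iSup_iff]
  rw [hU, measure_iUnion (disjoint_disjointed A) hmeas, ← ENNReal.tsum_mul_left]
  refine (ENNReal.tsum_le_tsum fun m => mul_haarG_le_setLIntegral (g := g) (hsat m)
    fun x hx => (disjointed_subset A m hx).le).trans ?_
  rw [← lintegral_iUnion hmeas (disjoint_disjointed A)]
  exact setLIntegral_le_lintegral _ _

/-- A reverse Hölder inequality: for a function that is constant on the intervals of generation
`N`, its averages over larger intervals are controlled by the averages of its `p`-th power,
where `p < 1`. This is the embedding of `ℓ_p` into `ℓ_1`, normalized. -/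
lemma avg_rpow_le {p : ℝ} (hp0 : 0 < p) (hp1 : p < 1) {h : G → ℝ≥0∞} {m N : ℕ} (hmN : m ≤ N)
    (hmeas : Measurable h) (hh : ∀ x, ∀ y ∈ I N x, h y = h x) (x : G) :
    avg h m x ^ p ≤ 2 ^ ((1 - p) * ((N : ℝ) - m)) * avg (fun y => h y ^ p) m x := by
  set J : ℝ≥0∞ := ∫⁻ y in I m x, h y ^ p ∂haarG with hJ
  -- The values of `h ^ p` on `I_m(x)` are bounded by `B`.
  set B : ℝ≥0∞ := 2 ^ N * J with hB
  have hval : ∀ y ∈ I m x, h y ^ p ≤ B := by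
    intro y hy
    have hsub : I N y ⊆ I m x := (I_antitone hmN y).trans (I_eq_of_mem hy).le
    calc h y ^ p = 2 ^ N * ∫⁻ z in I N y, h y ^ p ∂haarG := by
          rw [setLIntegral_const, mul_left_comm, two_pow_mul_haarG_I, mul_one]
      _ = 2 ^ N * ∫⁻ z in I N y, h z ^ p ∂haarG := by
          congr 1
          exact setLIntegral_congr_fun (measurableSet_I N y) fun z hz => by rw [hh y z hz]
      _ ≤ B := mul_le_mul_right (lintegral_mono_set hsub) _
  have hq : 0 ≤ (1 - p) / p := div_nonneg (by linarith) hp0.le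
  have hpt : ∀ y ∈ I m x, h y ≤ B ^ ((1 - p) / p) * h y ^ p := by
    intro y hy
    calc h y = (h y ^ p) ^ ((1 - p) / p) * h y ^ p := by
          rw [← ENNReal.rpow_mul, mul_div_cancel₀ _ hp0.ne',
            ← ENNReal.rpow_add_of_nonneg _ _ (by linarith) hp0.le]
          simp
      _ ≤ _ := mul_le_mul_left (ENNReal.rpow_le_rpow (hval y hy) hq) _
  have hint : ∫⁻ y in I m x, h y ∂haarG ≤ B ^ ((1 - p) / p) * J := by
    refine (setLIntegral_mono' (measurableSet_I m x) hpt).trans_eq ?_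
    exact lintegral_const_mul _ (hmeas.pow_const p)
  calc avg h m x ^ p ≤ (2 ^ m * (B ^ ((1 - p) / p) * J)) ^ p :=
        ENNReal.rpow_le_rpow (mul_le_mul_right hint _) hp0.le
    _ = 2 ^ (m * p) * (2 ^ (N * (1 - p)) * (J ^ (1 - p) * J ^ p)) := by
        rw [ENNReal.mul_rpow_of_nonneg _ _ hp0.le, ENNReal.mul_rpow_of_nonneg _ _ hp0.le,
          ← ENNReal.rpow_mul, div_mul_cancel₀ _ hp0.ne', hB,
          ENNReal.mul_rpow_of_nonneg _ _ (by linarith), ← ENNReal.rpow_natCast,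
          ← ENNReal.rpow_natCast, ← ENNReal.rpow_mul, ← ENNReal.rpow_mul, mul_assoc]
    _ = 2 ^ (m * p + N * (1 - p)) * J := by
        rw [← ENNReal.rpow_add_of_nonneg _ _ (by linarith) hp0.le, ← mul_assoc,
          ← ENNReal.rpow_add _ _ two_ne_zero ENNReal.ofNat_ne_top]
        simp
    _ = 2 ^ ((1 - p) * ((N : ℝ) - m)) * avg (fun y => h y ^ p) m x := by
        rw [avg, ← ENNReal.rpow_natCast, ← mul_assoc,
          ← ENNReal.rpow_add _ _ two_ne_zero ENNReal.ofNat_ne_top]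
        congr 2
        ring

/-! ### Boundedness of the weighted maximal operator -/

lemma idx_le (n : ℕ) : idx n ≤ 2 ^ (n + 1) := by
  have := Nat.pow_le_pow_right two_pos (Nat.div_le_self n 2)
  rw [idx, pow_succ]
  omega

/-- The coefficients `∫ F_n w_k` of a martingale do not depend on `n` once `k < 2 ^ n`. -/
lemma integral_mul_walsh_eq {F : ℕ → G → ℝ} (hF : Martingale F dyadic haarG) {k n j : ℕ}
    (hk : k < 2 ^ n) (hj : n ≤ j) :
    ∫ x, F j x * walsh k x ∂haarG = ∫ x, F n x * walsh k x ∂haarG := by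
  have hw : StronglyMeasurable[dyadic n] (walsh k) :=
    stronglyMeasurable_dyadic_of_eq fun x y hy => walsh_eq_of_mem_I hk hy
  have h1 := condExp_mul_of_stronglyMeasurable_right hw
    (integrable_mul_walsh (hF.integrable j) k) (hF.integrable j)
  rw [← integral_condExp (dyadic.le n)]
  refine integral_congr_ae ?_
  filter_upwards [h1, hF.condExp_ae_eq hj] with x hx1 hx2
  rw [← hx2]
  exact hx1

lemma martCoeff_eq {F : ℕ → G → ℝ} (hF : Martingale F dyadic haarG) {k n : ℕ}
    (hk : k < 2 ^ n) : martCoeff F k = coeff (F n) k := by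
  refine Tendsto.limUnder_eq (tendsto_const_nhds.congr' ?_)
  filter_upwards [eventually_ge_atTop n] with j hj
  exact (integral_mul_walsh_eq hF hk hj).symm

lemma martS_eq {F : ℕ → G → ℝ} (hF : Martingale F dyadic haarG) {N n : ℕ} (hN : N ≤ 2 ^ n)
    (x : G) : martS N F x = S N (F n) x :=
  Finset.sum_congr rfl fun k hk => by
    rw [martCoeff_eq hF ((Finset.mem_range.1 hk).trans_le hN)]

/-- The modulus of the kernel of order `2 ^ n + 2 ^ ⌊n / 2⌋` is at most the sum of the kernels of
orders `2 ^ n` and `2 ^ ⌊n / 2⌋`, which turn `|f|` into its averages. -/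
lemma ofReal_abs_S_idx_le {f : G → ℝ} (hf : Integrable f haarG) (n : ℕ) (x : G) :
    ENNReal.ofReal |S (idx n) f x| ≤
      avg (fun y => ENNReal.ofReal |f y|) n x + avg (fun y => ENNReal.ofReal |f y|) (n / 2) x := by
  have hind : ∀ m, avg (fun y => ENNReal.ofReal |f y|) m x =
      ∫⁻ y, (I m x).indicator (fun y => 2 ^ m * ENNReal.ofReal |f y|) y ∂haarG := fun m => by
    rw [lintegral_indicator (measurableSet_I m x), lintegral_const_mul' _ _ (by finiteness), avg]
  rw [S_eq_integral hf, hind, hind, ← Real.enorm_eq_ofReal_abs]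
  refine (enorm_integral_le_lintegral_enorm _).trans ?_
  rw [← lintegral_add_left' ((hf.aemeasurable.abs.ennreal_ofReal.const_mul _).indicator
    (measurableSet_I n x))]
  refine lintegral_mono fun y => ?_
  rw [sum_walsh_idx, mul_add]
  refine (enorm_add_le _ _).trans (add_le_add ?_ ?_)
  · by_cases hy : y ∈ I n x <;>
      simp [hy, Real.enorm_eq_ofReal_abs, mul_comm]
  · by_cases hy : y ∈ I (n / 2) x <;>
      simp [hy, Real.enorm_eq_ofReal_abs, mul_comm,
        abs_rademacher]

lemma weight_pos (p : ℝ) (n : ℕ) : 0 < weight p n := Real.rpow_pos_of_pos two_pos _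

lemma ofReal_weight_rpow {p : ℝ} (hp0 : 0 < p) (n : ℕ) :
    ENNReal.ofReal (weight p n) ^ p = 2 ^ ((1 - p) * ((n : ℝ) / 2)) := by
  rw [weight, ← ENNReal.ofReal_rpow_of_pos two_pos, ← ENNReal.rpow_mul, ENNReal.ofReal_ofNat]
  congr 1
  field_simp

/-- For averages over the intervals of generations between `⌊n / 2⌋` and `n`, the constant in
`avg_rpow_le` is at most a multiple of the `p`-th power of the weight. -/
lemma avg_rpow_le_weight {p : ℝ} (hp0 : 0 < p) (hp1 : p < 1) {h : G → ℝ≥0∞} {m n : ℕ}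
    (hm : n / 2 ≤ m) (hmn : m ≤ n) (hmeas : Measurable h)
    (hh : ∀ x, ∀ y ∈ I (n + 1) x, h y = h x) (x : G) :
    avg h m x ^ p ≤ 4 * ENNReal.ofReal (weight p n) ^ p * avg (fun y => h y ^ p) m x := by
  refine (avg_rpow_le hp0 hp1 (hmn.trans n.le_succ) hmeas hh x).trans (mul_le_mul_left ?_ _)
  -- The exponent is `(1 - p) * (n + 1 - m - n / 2) ≤ (1 - p) * 3 / 2 ≤ 2`.
  have hcast : (n : ℝ) ≤ 2 * m + 1 := by
    have : n ≤ 2 * m + 1 := by omega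
    exact_mod_cast this
  rw [ofReal_weight_rpow hp0, show (4 : ℝ≥0∞) = 2 ^ (2 : ℝ) by norm_num,
    ← ENNReal.rpow_add _ _ two_ne_zero ENNReal.ofNat_ne_top]
  refine ENNReal.rpow_le_rpow_of_exponent_le one_le_two ?_
  push_cast
  nlinarith

/-- The pointwise estimate behind the boundedness of the weighted maximal operator. -/
lemma maxOp_rpow_le {p : ℝ} (hp0 : 0 < p) (hp1 : p < 1) {F : ℕ → G → ℝ}
    (hF : Martingale F dyadic haarG) (x : G) :
    maxOp p F x ^ p ≤ 8 * dyadicMax (fun y => martMaximal F y ^ p) x := by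
  rw [maxOp, ← ENNReal.le_rpow_inv_iff hp0]
  refine iSup_le fun n => ?_
  rw [ENNReal.le_rpow_inv_iff hp0, ENNReal.ofReal_div_of_pos (weight_pos p n),
    ENNReal.div_rpow_of_nonneg _ _ hp0.le]
  refine ENNReal.div_le_of_le_mul ?_
  -- As `idx n ≤ 2 ^ (n + 1)`, the partial sum of `F` is that of `F (n + 1)`.
  set h : G → ℝ≥0∞ := fun y => ENNReal.ofReal |F (n + 1) y| with hh
  have hsm := hF.stronglyAdapted (n + 1)
  have hmeas : Measurable h :=
    ((hsm.mono (dyadic.le _)).measurable.abs).ennreal_ofReal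
  have hconst : ∀ x, ∀ y ∈ I (n + 1) x, h y = h x := fun x y hy => by
    simp only [hh, eq_of_stronglyMeasurable_dyadic hsm hy]
  have hmax : ∀ m, avg (fun y => h y ^ p) m x ≤ dyadicMax (fun y => martMaximal F y ^ p) x :=
    fun m => (avg_mono (fun y => ENNReal.rpow_le_rpow
      (le_iSup (fun n => ENNReal.ofReal |F n y|) (n + 1)) hp0.le) m x).trans
        (avg_le_dyadicMax _ m x)
  have hterm : ∀ m, n / 2 ≤ m → m ≤ n → avg h m x ^ p ≤
      4 * ENNReal.ofReal (weight p n) ^ p * dyadicMax (fun y => martMaximal F y ^ p) x :=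
    fun m h1 h2 => (avg_rpow_le_weight hp0 hp1 h1 h2 hmeas hconst x).trans
      (mul_le_mul_right (hmax m) _)
  calc ENNReal.ofReal |martS (idx n) F x| ^ p
      ≤ (avg h n x + avg h (n / 2) x) ^ p := by
        rw [martS_eq hF (idx_le n)]
        exact ENNReal.rpow_le_rpow (ofReal_abs_S_idx_le (hF.integrable _) n x) hp0.le
    _ ≤ avg h n x ^ p + avg h (n / 2) x ^ p :=
        ENNReal.rpow_add_le_add_rpow _ _ hp0.le hp1.le
    _ ≤ _ := add_le_add (hterm n (Nat.div_le_self n 2) le_rfl)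
        (hterm (n / 2) le_rfl (Nat.div_le_self n 2))
    _ = _ := by ring

/-- The weighted maximal operator is bounded from `H_p` to weak-`L_p`. -/
lemma weakLpNorm_maxOp_le {p : ℝ} (hp0 : 0 < p) (hp1 : p < 1) {F : ℕ → G → ℝ}
    (hF : Martingale F dyadic haarG) :
    weakLpNorm p (maxOp p F) ≤ 8 ^ (1 / p) * martHpNorm p F := by
  have hq : 0 ≤ 1 / p := by positivity
  rw [weakLpNorm, martHpNorm, lpNorm, ← ENNReal.mul_rpow_of_nonneg _ _ hq]
  refine ENNReal.rpow_le_rpow (iSup₂_le fun t _ => ?_) hq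
  set g : G → ℝ≥0∞ := fun y => martMaximal F y ^ p
  have hsub : {x | (t : ℝ≥0∞) < maxOp p F x} ⊆ {x | (t : ℝ≥0∞) ^ p / 8 < dyadicMax g x} := by
    intro x hx
    refine ENNReal.div_lt_of_lt_mul' ?_
    exact (ENNReal.rpow_lt_rpow hx hp0).trans_le (maxOp_rpow_le hp0 hp1 hF x)
  calc (t : ℝ≥0∞) ^ p * haarG {x | (t : ℝ≥0∞) < maxOp p F x}
      ≤ 8 * ((t : ℝ≥0∞) ^ p / 8) * haarG {x | (t : ℝ≥0∞) ^ p / 8 < dyadicMax g x} := by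
        rw [ENNReal.mul_div_cancel (by norm_num) (by norm_num)]
        exact mul_le_mul_right (measure_mono hsub) _
    _ ≤ 8 * ∫⁻ y, g y ∂haarG := by
        rw [mul_assoc]
        exact mul_le_mul_right (mul_haarG_dyadicMax_le g _) _

/-! ### Atoms showing sharpness -/

/-- The function `2 ^ (n / p) r_n` on `I_n(0)`, extended by zero. It is a multiple of the
difference of the Walsh–Dirichlet kernels of orders `2 ^ (n + 1)` and `2 ^ n`. -/
noncomputable def blockAtom (p : ℝ) (n : ℕ) : G → ℝ :=
  (I n 0).indicator fun x => 2 ^ ((n : ℝ) / p) * rademacher n x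

lemma measurable_blockAtom (p : ℝ) (n : ℕ) : Measurable (blockAtom p n) :=
  ((measurable_rademacher n).const_mul _).indicator (measurableSet_I n 0)

lemma support_blockAtom_subset (p : ℝ) (n : ℕ) : Function.support (blockAtom p n) ⊆ I n 0 :=
  Set.support_indicator_subset

lemma blockAtom_eq_zero {p : ℝ} {n : ℕ} {x : G} (h : x ∉ I n 0) : blockAtom p n x = 0 :=
  Set.indicator_of_notMem h _

lemma abs_blockAtom_le (p : ℝ) (n : ℕ) (x : G) : |blockAtom p n x| ≤ 2 ^ ((n : ℝ) / p) := by
  by_cases hx : x ∈ I n 0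
  · rw [blockAtom, Set.indicator_of_mem hx, abs_mul, abs_rademacher, mul_one, abs_of_pos (by positivity)]
  · rw [blockAtom_eq_zero hx, abs_zero]
    positivity

lemma integrable_blockAtom (p : ℝ) (n : ℕ) : Integrable (blockAtom p n) haarG :=
  Integrable.of_bound (measurable_blockAtom p n).aestronglyMeasurable _
    (ae_of_all _ (abs_blockAtom_le p n))

lemma blockAtom_eq (p : ℝ) (n : ℕ) (x : G) : blockAtom p n x =
    2 ^ ((n : ℝ) / p) * (2 * (I (n + 1) 0).indicator 1 x - (I n 0).indicator 1 x) := by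
  by_cases hx : x ∈ I n 0
  · have hiff : x ∈ I (n + 1) 0 ↔ x n = 0 := mem_I_succ_iff hx
    by_cases h : x n = 0
    · simp [blockAtom, hx, hiff.2 h, rademacher, h]
      norm_num
    · have h1 : x n = 1 := by omega
      simp [blockAtom, hx, mt hiff.1 h, rademacher, h1]
  · have : x ∉ I (n + 1) 0 := fun h => hx (I_antitone n.le_succ 0 h)
    simp [blockAtom, hx, this]

lemma integral_blockAtom (p : ℝ) (n : ℕ) : ∫ x, blockAtom p n x ∂haarG = 0 := by
  have hi : ∀ m, Integrable ((I m 0).indicator (1 : G → ℝ)) haarG := fun m =>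
    (integrable_const (1 : ℝ)).indicator (measurableSet_I m 0)
  simp_rw [blockAtom_eq]
  rw [integral_const_mul, integral_sub ((hi _).const_mul 2) (hi _), integral_const_mul,
    integral_indicator_one (measurableSet_I _ _), integral_indicator_one (measurableSet_I _ _),
    haarG_real_I, haarG_real_I, pow_succ]
  field_simp
  simp

lemma isAtom_blockAtom {p : ℝ} (n : ℕ) : IsAtom p (blockAtom p n) := by
  refine ⟨measurable_blockAtom p n, ⟨_, abs_blockAtom_le p n⟩, n, 0, integral_blockAtom p n, ?_,
    support_blockAtom_subset p n⟩
  rw [eLpNorm_exponent_top]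
  refine (eLpNormEssSup_le_of_ae_bound (ae_of_all _ (abs_blockAtom_le p n))).trans_eq ?_
  rw [haarG_I, ENNReal.inv_rpow, ← ENNReal.rpow_neg, neg_neg, ← ENNReal.rpow_natCast,
    ← ENNReal.rpow_mul, ← ENNReal.ofReal_rpow_of_pos two_pos, ENNReal.ofReal_ofNat]
  congr 1
  ring

/-- The integral of `blockAtom` vanishes over a dyadic interval which either contains `I_n(0)` or
is disjoint from it. -/
lemma setIntegral_blockAtom (p : ℝ) {n j : ℕ} {x : G} (h : j ≤ n ∨ x ∉ I n 0) :
    ∫ y in I j x, blockAtom p n y ∂haarG = 0 := by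
  by_cases hx : j ≤ n ∧ (0 : G) ∈ I j x
  · rw [setIntegral_eq_integral_of_forall_compl_eq_zero, integral_blockAtom]
    intro y hy
    refine blockAtom_eq_zero fun hy0 => hy ?_
    rw [← I_eq_of_mem hx.2]
    exact I_antitone hx.1 0 hy0
  · refine setIntegral_eq_zero_of_forall_eq_zero fun y hy => blockAtom_eq_zero fun hy0 => ?_
    rcases le_total j n with hj | hj
    · refine hx ⟨hj, ?_⟩
      rw [← I_eq_of_mem hy, mem_I_comm]
      exact I_antitone hj 0 hy0
    · rcases h with h | h
      · obtain rfl := le_antisymm h hj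
        exact hx ⟨le_rfl, by rw [← I_eq_of_mem hy, mem_I_comm]; exact hy0⟩
      · refine h ?_
        rw [← I_eq_of_mem hy0, mem_I_comm]
        exact I_antitone hj x hy

lemma hpNorm_blockAtom_le {p : ℝ} (hp0 : 0 < p) (n : ℕ) : hpNorm p (blockAtom p n) ≤ 1 := by
  have hmax : ∀ x, maximal (blockAtom p n) x ≤
      (I n 0).indicator (fun _ => 2 ^ ((n : ℝ) / p)) x := by
    intro x
    refine iSup_le fun j => ?_
    by_cases hx : x ∈ I n 0
    · rw [Set.indicator_of_mem hx, ← ENNReal.ofReal_ofNat, ENNReal.ofReal_rpow_of_pos two_pos]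
      refine ENNReal.ofReal_le_ofReal ?_
      rw [setAverage_eq, smul_eq_mul, abs_mul, abs_inv, abs_of_nonneg measureReal_nonneg]
      refine inv_mul_le_of_le_mul₀ measureReal_nonneg (by positivity) ?_
      rw [mul_comm]
      exact norm_setIntegral_le_of_norm_le_const (f := blockAtom p n) (measure_lt_top _ _)
        fun y _ => abs_blockAtom_le p n y
    · rw [setAverage_eq, setIntegral_blockAtom p (Or.inr hx)]
      simp
  have hpow : ∫⁻ x, maximal (blockAtom p n) x ^ p ∂haarG ≤ 1 := by
    calc ∫⁻ x, maximal (blockAtom p n) x ^ p ∂haarG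
        ≤ ∫⁻ x, (I n 0).indicator (fun _ => 2 ^ n) x ∂haarG := by
          refine lintegral_mono fun x => (ENNReal.rpow_le_rpow (hmax x) hp0.le).trans ?_
          by_cases hx : x ∈ I n 0
          · simp [hx, ← ENNReal.rpow_mul, div_mul_cancel₀ _ hp0.ne']
          · simp [hx, hp0]
      _ = 1 := by
          rw [lintegral_indicator_const (measurableSet_I n 0), two_pow_mul_haarG_I]
  exact (ENNReal.rpow_le_rpow hpow (by positivity)).trans_eq (ENNReal.one_rpow _)

/-- The part of the kernel of order `2 ^ n` annihilates the atom, while the other part spreads it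
from `I_n(0)` to the larger interval of generation `⌊n / 2⌋`. -/
lemma S_idx_blockAtom (p : ℝ) (n : ℕ) {x : G} (hx : x ∈ I (n / 2) 0) :
    S (idx n) (blockAtom p n) x =
      rademacher n x * (2 ^ (n / 2) * (2 ^ ((n : ℝ) / p) * (2 ^ n)⁻¹)) := by
  have hle : n / 2 ≤ n := Nat.div_le_self n 2
  have key : ∀ y, blockAtom p n y * ∑ k ∈ Finset.range (idx n), walsh k x * walsh k y =
      2 ^ n * (I n x).indicator (blockAtom p n) y +
        rademacher n x * 2 ^ (n / 2) * 2 ^ ((n : ℝ) / p) * (I n 0).indicator 1 y := by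
    intro y
    rw [sum_walsh_idx, mul_add]
    congr 1
    · by_cases hy : y ∈ I n x <;> simp [hy, mul_comm]
    · by_cases hy : y ∈ I n 0
      · have : y ∈ I (n / 2) x := by
          rw [I_eq_of_mem hx]
          exact I_antitone hle 0 hy
        have hr : rademacher n y * rademacher n y = 1 := by
          rw [← abs_mul_abs_self, abs_rademacher, one_mul]
        simp only [blockAtom, hy, this, Set.indicator_of_mem, Pi.one_apply]
        linear_combination (2 ^ ((n : ℝ) / p) * rademacher n x * 2 ^ (n / 2)) * hr
      · simp [blockAtom_eq_zero hy, hy]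
  rw [S_eq_integral (integrable_blockAtom p n)]
  simp_rw [key]
  have h1 : Integrable ((I n 0).indicator (1 : G → ℝ)) haarG :=
    (integrable_const (1 : ℝ)).indicator (measurableSet_I n 0)
  rw [integral_add (((integrable_blockAtom p n).indicator (measurableSet_I n x)).const_mul _)
      (h1.const_mul _), integral_const_mul, integral_const_mul, integral_indicator (measurableSet_I n x),
    setIntegral_blockAtom p (Or.inl le_rfl), integral_indicator_one (measurableSet_I n 0),
    haarG_real_I]
  ring

lemma le_weakLpNorm {p : ℝ} (hp0 : 0 < p) {g : G → ℝ≥0∞} {A : Set G} {t : ℝ≥0} (ht : 0 < t)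
    (hA : ∀ x ∈ A, t < g x) : t * haarG A ^ (1 / p) ≤ weakLpNorm p g := by
  have hq : 0 ≤ 1 / p := by positivity
  calc (t : ℝ≥0∞) * haarG A ^ (1 / p) = ((t : ℝ≥0∞) ^ p * haarG A) ^ (1 / p) := by
        rw [ENNReal.mul_rpow_of_nonneg _ _ hq, ← ENNReal.rpow_mul, mul_one_div_cancel hp0.ne',
          ENNReal.rpow_one]
    _ ≤ _ := ENNReal.rpow_le_rpow ((mul_le_mul_right (measure_mono hA) _).trans
        (le_iSup₂ (f := fun (t : ℝ≥0) (_ : 0 < t) =>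
          (t : ℝ≥0∞) ^ p * haarG {x | (t : ℝ≥0∞) < g x}) t ht)) hq

/-- For even `n` the partial sum of order `2 ^ n + 2 ^ (n / 2)` of `blockAtom p n` has weak-`L_p`
quasi-norm comparable to `weight p n`. The factor `1 / 2` makes the level strictly smaller than
the modulus of the partial sum. -/
lemma le_weakLpNorm_S_blockAtom {p : ℝ} (hp0 : 0 < p) {n : ℕ} (hn : Even n) {c : ℝ}
    (hc : 0 < c) :
    ENNReal.ofReal (weight p n / c / 2) ≤
      weakLpNorm p (fun x => ENNReal.ofReal |S (idx n) (blockAtom p n) x / c|) := by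
  obtain ⟨m, rfl⟩ := hn
  set v : ℝ := 2 ^ ((2 * m : ℝ) / p - m) / c with hv
  have hvpos : 0 < v := by positivity
  have hS : ∀ x ∈ I m 0, |S (idx (m + m)) (blockAtom p (m + m)) x / c| = v := by
    intro x hx
    have hm : (m + m) / 2 = m := by omega
    rw [S_idx_blockAtom p (m + m) (by rwa [hm]), abs_div, abs_mul, abs_rademacher, one_mul, hm,
      abs_of_pos hc, abs_of_pos (by positivity), hv, Real.rpow_sub two_pos, Real.rpow_natCast]
    push_cast
    rw [pow_add, ← two_mul]
    field_simp
  have hA : ∀ x ∈ I m 0, ((v / 2).toNNReal : ℝ≥0∞) <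
      ENNReal.ofReal |S (idx (m + m)) (blockAtom p (m + m)) x / c| := fun x hx => by
    rw [hS x hx]
    exact (ENNReal.ofReal_lt_ofReal_iff hvpos).2 (half_lt_self hvpos)
  refine le_trans (le_of_eq ?_) (le_weakLpNorm hp0 (Real.toNNReal_pos.2 (half_pos hvpos)) hA)
  have hI : haarG (I m 0) ^ (1 / p) = ENNReal.ofReal (2 ^ (-((m : ℝ) / p))) := by
    rw [haarG_I, ENNReal.inv_rpow, ← ENNReal.rpow_natCast, ← ENNReal.rpow_mul,
      ← ENNReal.rpow_neg, ← ENNReal.ofReal_rpow_of_pos two_pos, ENNReal.ofReal_ofNat]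
    congr 1
    ring
  rw [hI]
  change _ = ENNReal.ofReal (v / 2) * _
  rw [← ENNReal.ofReal_mul (by positivity)]
  congr 1
  have hw : weight p (m + m) =
      2 ^ ((2 * m : ℝ) / p - m) * 2 ^ (-((m : ℝ) / p)) := by
    rw [weight, ← Real.rpow_add two_pos]
    congr 1
    push_cast
    ring
  rw [hw, hv]
  ring

lemma weight_succ (p : ℝ) (n : ℕ) :
    weight p (n + 1) = 2 ^ (1 / 2 * (1 / p - 1)) * weight p n := by
  rw [weight, weight, ← Real.rpow_add two_pos]
  congr 1
  push_cast
  ring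

/-- If `weight p n / ψ n` is unbounded and `ψ` is nondecreasing, then the atoms `blockAtom p n`
with even `n` witness the unboundedness of the partial sums normalized by `ψ`. -/
lemma iSup_weakLpNorm_blockAtom {p : ℝ} (hp0 : 0 < p) {ψ : ℕ → ℝ} (hψ : Monotone ψ)
    (hψ1 : ∀ n, 1 ≤ ψ n)
    (hlim : limsup (fun n : ℕ => ENNReal.ofReal (weight p n / ψ n)) atTop = ∞) :
    (⨆ (n : ℕ) (_ : Even n),
      weakLpNorm p (fun x => ENNReal.ofReal |S (idx n) (blockAtom p n) x / ψ n|) /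
        hpNorm p (blockAtom p n)) = ∞ := by
  have hψ0 : ∀ n, 0 < ψ n := fun n => one_pos.trans_le (hψ1 n)
  set L := ⨆ (n : ℕ) (_ : Even n),
    weakLpNorm p (fun x => ENNReal.ofReal |S (idx n) (blockAtom p n) x / ψ n|) /
      hpNorm p (blockAtom p n) with hL
  have heven : ∀ n, Even n → ENNReal.ofReal (weight p n / ψ n) ≤ 2 * L := by
    intro n hn
    have h1 : ENNReal.ofReal (weight p n / ψ n / 2) ≤ L :=
      (le_weakLpNorm_S_blockAtom hp0 hn (hψ0 n)).trans <|
        ((div_one _).symm.le.trans (ENNReal.div_le_div_left (hpNorm_blockAtom_le hp0 n) _)).trans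
          (le_iSup₂ (f := fun (n : ℕ) (_ : Even n) =>
            weakLpNorm p (fun x => ENNReal.ofReal |S (idx n) (blockAtom p n) x / ψ n|) /
              hpNorm p (blockAtom p n)) n hn)
    calc ENNReal.ofReal (weight p n / ψ n) = 2 * ENNReal.ofReal (weight p n / ψ n / 2) := by
          rw [← ENNReal.ofReal_ofNat, ← ENNReal.ofReal_mul zero_le_two]
          congr 1
          ring
      _ ≤ 2 * L := mul_le_mul_right h1 _
  -- An odd `n` is reduced to `n - 1`: the weight grows by a fixed factor and `ψ (n - 1) ≤ ψ n`.
  set K : ℝ := max 1 (2 ^ (1 / 2 * (1 / p - 1))) with hK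
  have hK1 : 1 ≤ K := le_max_left _ _
  have hall : ∀ n, ENNReal.ofReal (weight p n / ψ n) ≤ ENNReal.ofReal K * (2 * L) := by
    intro n
    rcases Nat.even_or_odd n with hn | ⟨m, rfl⟩
    · refine (heven n hn).trans (le_mul_of_one_le_left' ?_)
      exact ENNReal.one_le_ofReal.2 hK1
    · refine le_trans ?_ (mul_le_mul_right (heven (2 * m) (even_two_mul m)) _)
      rw [← ENNReal.ofReal_mul (by positivity), weight_succ, mul_div_assoc]
      have hw := weight_pos p (2 * m)
      refine ENNReal.ofReal_le_ofReal (mul_le_mul (le_max_right _ _) ?_ ?_ (by positivity))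
      · exact div_le_div_of_nonneg_left hw.le (hψ0 _) (hψ (Nat.le_succ _))
      · exact (div_pos hw (hψ0 _)).le
  have htop : ENNReal.ofReal K * (2 * L) = ∞ := by
    rw [eq_top_iff, ← hlim]
    exact limsup_le_of_le (by isBoundedDefault) (Eventually.of_forall hall)
  by_contra hne
  exact (by finiteness : ENNReal.ofReal K * (2 * L) ≠ ∞) htop

lemma monotone_idx : Monotone idx := fun _ _ h =>
  add_le_add (Nat.pow_le_pow_right two_pos h)
    (Nat.pow_le_pow_right two_pos (Nat.div_le_div_right h))

end WalshHardy

theorem corollary3 (p : ℝ) (hp0 : 0 < p) (hp1 : p < 1) :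
    -- boundedness from the Hardy space to weak-L_p
    (∃ C : ℝ≥0, ∀ F : ℕ → WalshHardy.G → ℝ, WalshHardy.MemHp p F →
      WalshHardy.weakLpNorm p (WalshHardy.maxOp p F) ≤ C * WalshHardy.martHpNorm p F) ∧
    -- sharpness, with the normalizing function evaluated at n
    (∀ φ : ℕ → ℝ, Monotone φ → (∀ n, 1 ≤ φ n) →
      limsup (fun n : ℕ => ENNReal.ofReal (WalshHardy.weight p n / φ n)) atTop = ∞ →
      ∃ f : ℕ → WalshHardy.G → ℝ, (∀ n, WalshHardy.IsAtom p (f n)) ∧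
        (⨆ (n : ℕ) (_ : Even n),
          WalshHardy.weakLpNorm p
              (fun x => ENNReal.ofReal |WalshHardy.S (WalshHardy.idx n) (f n) x / φ n|) /
            WalshHardy.hpNorm p (f n)) = ∞) ∧
    -- sharpness, with the normalizing function evaluated at the index of the partial sum
    (∀ φ : ℕ → ℝ, Monotone φ → (∀ n, 1 ≤ φ n) →
      limsup (fun n : ℕ =>
        ENNReal.ofReal (WalshHardy.weight p n / φ (WalshHardy.idx n))) atTop = ∞ →
      ∃ f : ℕ → WalshHardy.G → ℝ, (∀ n, WalshHardy.IsAtom p (f n)) ∧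
        (⨆ (n : ℕ) (_ : Even n),
          WalshHardy.weakLpNorm p
              (fun x => ENNReal.ofReal
                |WalshHardy.S (WalshHardy.idx n) (f n) x / φ (WalshHardy.idx n)|) /
            WalshHardy.hpNorm p (f n)) = ∞) := by
  refine ⟨⟨8 ^ (1 / p), fun F hF => ?_⟩, fun φ hφ hφ1 hlim => ?_, fun φ hφ hφ1 hlim => ?_⟩
  · rw [ENNReal.coe_rpow_of_nonneg _ (by positivity)]
    exact WalshHardy.weakLpNorm_maxOp_le hp0 hp1 hF.1
  · exact ⟨WalshHardy.blockAtom p, WalshHardy.isAtom_blockAtom,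
      WalshHardy.iSup_weakLpNorm_blockAtom hp0 hφ hφ1 hlim⟩
  · exact ⟨WalshHardy.blockAtom p, WalshHardy.isAtom_blockAtom,
      WalshHardy.iSup_weakLpNorm_blockAtom hp0 (hφ.comp WalshHardy.monotone_idx)
        (fun n => hφ1 _) hlim⟩
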